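/- Let $\mathbb K$ be $\mathbb R$ or $\mathbb C$; all spaces are Banach spaces over $\mathbb K$. A double arrow $(f,\overline f):A\leftrightarrows B$ consists of a linear isometric embedding $f:A\to B$ and a continuous linear operator $\overline f:B\to A$ with $\|\overline f\|\le 1$ and $\overline f f=1_A$; if one exists, we say that $B$ contains an isometric $1$-complemented copy of $A$. A Banach space $E$ is said to be of $\omega$-universal complemented disposition if for all double arrows $(i,\overline i):S_1\leftrightarrows S_2$ between separable Banach spaces and $(j,\overline j):S_1\leftrightarrows E$ there is a double arrow $(J,\overline J):S_2\leftrightarrows E$ with $Ji=j$. A Banach space $E$ has an $\omega$-skeleton if there is an increasing chain $(E_\alpha)_{\alpha<\omega_1}$ of closed separable subspaces with $\overline{\bigcup_{\alpha<\omega_1}E_\alpha}=E$, with $E_\beta=\overline{\bigcup_{\alpha<\beta}E_\alpha}$ for every limit ordinal $\beta<\omega_1$, and such that for each $\alpha<\omega_1$ the inclusion $E_\alpha\subseteq E_{\alpha+1}$ is the embedding of a double arrow $E_\alpha\leftrightarrows E_{\alpha+1}$. Assume the continuum hypothesis $2^{\aleph_0}=\aleph_1$. Then every Banach space of $\omega$-universal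 complemented disposition that has an $\omega$-skeleton contains an isometric $1$-complemented copy of every Banach space that has an $\omega$-skeleton. -/

import Mathlib

open scoped Ordinal Cardinal

universe u v w

/-- A double arrow `A ⇄ B` between normed spaces: a linear isometric embedding `emb : A → B`
together with a continuous linear operator `proj : B → A` of norm at most `1` such that
`proj ∘ emb = id`. Thus `emb ∘ proj` is a norm-at-most-one projection of `B` onto the
isometric copy `emb(A)` of `A`. -/
structure DoubleArrow (𝕜 : Type w) [RCLike 𝕜]
    (A : Type u) [NormedAddCommGroup A] [NormedSpace 𝕜 A]
    (B : Type v) [NormedAddCommGroup B] [NormedSpace 𝕜 B] where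
  emb : A →ₗᵢ[𝕜] B
  proj : B →L[𝕜] A
  norm_proj_le : ‖proj‖ ≤ 1
  proj_emb : ∀ a : A, proj (emb a) = a

/-- `E` is of `ω`-universal complemented disposition: for all double arrows `i : S₁ ⇄ S₂` between
separable Banach spaces and `j : S₁ ⇄ E` there is a double arrow `J : S₂ ⇄ E` whose embedding
extends that of `j` along `i`. (A separable Banach space has at most continuum many points, so it
is enough to let `S₁`, `S₂` range over `Type`.)

No compatibility of the projections is demanded: if one also demanded
`i.proj ∘ J.proj = j.proj`, the condition would become stronger (see
`IsOmegaUCDCommuting.isOmegaUCD`); in fact no space would satisfy it. -/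
def IsOmegaUCD (𝕜 : Type w) [RCLike 𝕜]
    (E : Type u) [NormedAddCommGroup E] [NormedSpace 𝕜 E] : Prop :=
  ∀ (S₁ S₂ : Type)
    [NormedAddCommGroup S₁] [NormedSpace 𝕜 S₁] [CompleteSpace S₁]
    [TopologicalSpace.SeparableSpace S₁]
    [NormedAddCommGroup S₂] [NormedSpace 𝕜 S₂] [CompleteSpace S₂]
    [TopologicalSpace.SeparableSpace S₂]
    (i : DoubleArrow 𝕜 S₁ S₂) (j : DoubleArrow 𝕜 S₁ E),
    ∃ J : DoubleArrow 𝕜 S₂ E, ∀ s : S₁, J.emb (i.emb s) = j.emb s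

/-- The stronger form of `IsOmegaUCD`, in which the triangle of projections has to commute too. -/
def IsOmegaUCDCommuting (𝕜 : Type w) [RCLike 𝕜]
    (E : Type u) [NormedAddCommGroup E] [NormedSpace 𝕜 E] : Prop :=
  ∀ (S₁ S₂ : Type)
    [NormedAddCommGroup S₁] [NormedSpace 𝕜 S₁] [CompleteSpace S₁]
    [TopologicalSpace.SeparableSpace S₁]
    [NormedAddCommGroup S₂] [NormedSpace 𝕜 S₂] [CompleteSpace S₂]
    [TopologicalSpace.SeparableSpace S₂]
    (i : DoubleArrow 𝕜 S₁ S₂) (j : DoubleArrow 𝕜 S₁ E),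
    ∃ J : DoubleArrow 𝕜 S₂ E,
      (∀ s : S₁, J.emb (i.emb s) = j.emb s) ∧ ∀ x : E, i.proj (J.proj x) = j.proj x

theorem IsOmegaUCDCommuting.isOmegaUCD {𝕜 : Type w} [RCLike 𝕜]
    {E : Type u} [NormedAddCommGroup E] [NormedSpace 𝕜 E]
    (h : IsOmegaUCDCommuting 𝕜 E) : IsOmegaUCD 𝕜 E := by
  intro S₁ S₂ _ _ _ _ _ _ _ _ i j
  obtain ⟨J, hJ, _⟩ := h S₁ S₂ i j
  exact ⟨J, hJ⟩

/-- `E` has an `ω`-skeleton: a continuous increasing chain `(V α)`, `α < ω₁`, of closed separable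
subspaces with dense union, such that for each `α` the inclusion `V α ⊆ V (α + 1)` is the
embedding of a double arrow `V α ⇄ V (α + 1)`. (The values `V α` for `α ≥ ω₁` are irrelevant.) -/
def HasOmegaSkeleton (𝕜 : Type w) [RCLike 𝕜]
    (E : Type u) [NormedAddCommGroup E] [NormedSpace 𝕜 E] : Prop :=
  ∃ V : Ordinal.{0} → Submodule 𝕜 E,
    (∀ α < ω₁, IsClosed (V α : Set E)) ∧
    (∀ α < ω₁, TopologicalSpace.IsSeparable (V α : Set E)) ∧
    (∀ α β, α ≤ β → β < ω₁ → V α ≤ V β) ∧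
    (∀ β < ω₁, Order.IsSuccLimit β → (V β : Set E) = closure (⋃ α < β, (V α : Set E))) ∧
    (∀ α < ω₁, ∃ d : DoubleArrow 𝕜 (V α) (V (α + 1)), ∀ x : V α, (d.emb x : E) = (x : E)) ∧
    closure (⋃ α < (ω₁ : Ordinal.{0}), (V α : Set E)) = Set.univ

/-!
Let `(V α)` be a skeleton of `Y` and `(W α)` a skeleton of `E`. The double arrow `Y ⇄ E` is the
union of an `ω₁`-chain of *partial double arrows*: pairs of partial linear maps `j` from `Y` to `E`
and `p` from `E` to `Y` that restrict to a double arrow `j.domain ⇄ p.domain`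
(`IsPartialDoubleArrow`). Restricting the projections to members of the skeleton of `E` is what
allows them to be extended coherently, although universal complemented disposition says nothing
about projections.

The chain consists of partial double arrows `V α ⇄ W γ`. Countable chains of these are bounded: the
union of such a chain extends to the closures of its two domains, which are again members of the
skeletons. A single `V α ⇄ W γ` extends to a partial double arrow whose domains contain prescribed
members of the skeletons (`IsPartialDoubleArrow.exists_le`). To see this, amalgamate `V α ⇄ V α'`
and `V α ⇄ W γ`: the pullback of the two projections inside `V α' × W γ`, with the maximum norm, is
a separable Banach space `X` with double arrows `V α' ⇄ X` and `W γ ⇄ X` whose embeddings agree on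
`V α` (`DoubleArrow.amalgam`). Since `W γ` is complemented in `E`
(`IsOmegaSkeleton.isOneComplemented`), its inclusion extends to a double arrow `X ⇄ E`. The
composite `V α' ⇄ X ⇄ E` extends the given embedding, and its projection restricted to `W γ` is the
given projection (`IsOmegaUCD.exists_extension_of_amalgam`). The image of `V α'` is separable, so
it lies in some `W γ'`, to which the projection is then restricted.

A transfinite recursion (`exists_monotone_mem_of_countable_chains_bounded`) yields an `ω₁`-chain
whose domains exhaust `Y` and `E`. No completion is needed in the end, since the union of a skeleton
is already closed (`IsOmegaSkeleton.exists_mem`).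
-/

open Set

/-! ### Generic chains of length `ω₁` -/

theorem Ordinal.countable_Iio_of_lt_omega_one {α : Ordinal.{0}} (hα : α < ω₁) :
    (Iio α).Countable := by
  rw [← Cardinal.le_aleph0_iff_set_countable]
  have h : α.card < ℵ₁ := by
    rwa [← Cardinal.lt_ord, Cardinal.ord_aleph]
  rw [← Cardinal.succ_aleph0, Order.lt_succ_iff] at h
  rw [Cardinal.mk_Iio_ordinal]
  rwa [← Cardinal.lift_le_aleph0.{0, 1}] at h

/-- In a preorder in which countable chains are bounded, there is an increasing `ω₁`-sequence that
meets `ω₁` many prescribed cofinal sets. -/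
theorem exists_monotone_mem_of_countable_chains_bounded {S : Type*} [Preorder S]
    (hub : ∀ c : Set S, c.Countable → IsChain (· ≤ ·) c → BddAbove c)
    (D : Ordinal.{0} → Set S) (hD : ∀ α < ω₁, ∀ x, ∃ y ∈ D α, x ≤ y) :
    ∃ f : Ordinal.{0} → S, (∀ α < ω₁, f α ∈ D α) ∧ ∀ α β, α ≤ β → β < ω₁ → f α ≤ f β := by
  classical
  obtain ⟨s₀, -⟩ := hub ∅ countable_empty IsChain.empty
  -- `f α` is chosen in `D α` above all earlier values; `s₀` is only a default value
  let F : (α : Ordinal.{0}) → ((β : Ordinal.{0}) → β < α → S) → S := fun α f =>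
    if h : ∃ u ∈ D α, ∀ β (hβ : β < α), f β hβ ≤ u then h.choose else s₀
  let f : Ordinal.{0} → S := Ordinal.lt_wf.fix F
  have key : ∀ α, α < ω₁ → f α ∈ D α ∧ ∀ β < α, f β ≤ f α := by
    intro α
    induction α using WellFoundedLT.induction with
    | ind α ih =>
      intro hα
      have hchain : IsChain (· ≤ ·) (f '' Iio α) := by
        rintro _ ⟨β, hβ, rfl⟩ _ ⟨γ, hγ, rfl⟩ hne
        rcases lt_trichotomy β γ with h | rfl | h
        · exact Or.inl ((ih γ hγ (lt_trans hγ hα)).2 β h)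
        · exact absurd rfl hne
        · exact Or.inr ((ih β hβ (lt_trans hβ hα)).2 γ h)
      obtain ⟨b, hb⟩ := hub _ ((Ordinal.countable_Iio_of_lt_omega_one hα).image f) hchain
      obtain ⟨u, huD, hbu⟩ := hD α hα b
      have hex : ∃ u ∈ D α, ∀ β (_ : β < α), f β ≤ u :=
        ⟨u, huD, fun β hβ => (hb (mem_image_of_mem f hβ)).trans hbu⟩
      have hf : f α = hex.choose := by
        have h : f α = F α fun β _ => f β := Ordinal.lt_wf.fix_eq F α
        rw [h]
        exact dif_pos hex
      rw [hf]
      exact hex.choose_spec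
  refine ⟨f, fun α hα => (key α hα).1, fun α β hαβ hβ => ?_⟩
  rcases hαβ.eq_or_lt with rfl | h
  · exact le_rfl
  · exact (key β hβ).2 α h

/-! ### Contractive partial linear maps -/

section PartialMaps

variable {𝕜 : Type w} [RCLike 𝕜]
  {E : Type u} [NormedAddCommGroup E] [NormedSpace 𝕜 E]
  {F : Type v} [NormedAddCommGroup F] [NormedSpace 𝕜 F]

theorem Submodule.denseRange_inclusion_topologicalClosure (A : Submodule 𝕜 E) :
    DenseRange (Submodule.inclusion A.le_topologicalClosure) := by
  exact (denseRange_inclusion_iff (show (A : Set E) ⊆ A.topologicalClosure from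
    A.le_topologicalClosure)).2 A.topologicalClosure_coe.le

variable [CompleteSpace F]

/-- The extension of a partial linear map to the closure of its domain, meaningful for bounded
maps into a complete space. -/
noncomputable def LinearPMap.closureExtension (q : E →ₗ.[𝕜] F) : E →ₗ.[𝕜] F where
  domain := q.domain.topologicalClosure
  toFun := (q.toFun.extendOfNorm (Submodule.inclusion q.domain.le_topologicalClosure)).toLinearMap

variable {q : E →ₗ.[𝕜] F}

theorem LinearPMap.continuous_closureExtension : Continuous q.closureExtension :=
  (q.toFun.extendOfNorm
    (Submodule.inclusion q.domain.le_topologicalClosure)).continuous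

theorem LinearPMap.closureExtension_inclusion (hq : ∀ x, ‖q x‖ ≤ ‖x‖) (x : q.domain) :
    q.closureExtension (Submodule.inclusion q.domain.le_topologicalClosure x) = q x :=
  LinearMap.extendOfNorm_eq (q.domain.denseRange_inclusion_topologicalClosure)
    ⟨1, fun x => by simpa using! hq x⟩ x

theorem LinearPMap.norm_closureExtension_le (hq : ∀ x, ‖q x‖ ≤ ‖x‖)
    (x : q.closureExtension.domain) : ‖q.closureExtension x‖ ≤ ‖x‖ := by
  have := LinearMap.norm_extendOfNorm_apply_le (f := q.toFun)
    (q.domain.denseRange_inclusion_topologicalClosure) 1 (fun x => by simpa using! hq x) x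
  rwa [one_mul] at this

theorem LinearPMap.le_closureExtension (hq : ∀ x, ‖q x‖ ≤ ‖x‖) : q ≤ q.closureExtension := by
  refine ⟨q.domain.le_topologicalClosure, fun x y hxy => ?_⟩
  rw [← closureExtension_inclusion hq x]
  congr 1
  exact Subtype.ext hxy

end PartialMaps

/-! ### Partial double arrows -/

section PartialDoubleArrows

variable {𝕜 : Type w} [RCLike 𝕜]
  {E : Type u} [NormedAddCommGroup E] [NormedSpace 𝕜 E]
  {Y : Type v} [NormedAddCommGroup Y] [NormedSpace 𝕜 Y]

/-- The partial linear maps `j` from `Y` to `E` and `p` from `E` to `Y` are the embedding and the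
projection of a double arrow `j.domain ⇄ p.domain`. -/
structure IsPartialDoubleArrow (j : Y →ₗ.[𝕜] E) (p : E →ₗ.[𝕜] Y) : Prop where
  norm_emb : ∀ y, ‖j y‖ = ‖y‖
  norm_proj_le : ∀ x, ‖p x‖ ≤ ‖x‖
  emb_mem : ∀ y, j y ∈ p.domain
  proj_mem : ∀ x, p x ∈ j.domain
  proj_emb : ∀ y, p ⟨j y, emb_mem y⟩ = y

namespace IsPartialDoubleArrow

theorem bot : IsPartialDoubleArrow (⊥ : Y →ₗ.[𝕜] E) (⊥ : E →ₗ.[𝕜] Y) where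
  norm_emb y := by
    obtain rfl : y = 0 := Subsingleton.elim (α := (⊥ : Submodule 𝕜 Y)) y 0
    simp
  norm_proj_le x := by
    obtain rfl : x = 0 := Subsingleton.elim (α := (⊥ : Submodule 𝕜 E)) x 0
    simp
  emb_mem y := by
    obtain rfl : y = 0 := Subsingleton.elim (α := (⊥ : Submodule 𝕜 Y)) y 0
    simp
  proj_mem x := by
    obtain rfl : x = 0 := Subsingleton.elim (α := (⊥ : Submodule 𝕜 E)) x 0
    simp
  proj_emb y := by
    obtain rfl : y = 0 := Subsingleton.elim (α := (⊥ : Submodule 𝕜 Y)) y 0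
    have h : ∀ x : (⊥ : E →ₗ.[𝕜] Y).domain, (⊥ : E →ₗ.[𝕜] Y) x = 0 := fun x => by
      obtain rfl : x = 0 := Subsingleton.elim (α := (⊥ : Submodule 𝕜 E)) x 0
      simp
    rw [h]
    rfl

theorem nonempty_doubleArrow {j : Y →ₗ.[𝕜] E} {p : E →ₗ.[𝕜] Y} (h : IsPartialDoubleArrow j p) :
    ∃ d : DoubleArrow 𝕜 j.domain p.domain,
      (∀ y, (d.emb y : E) = j y) ∧ ∀ x, (d.proj x : Y) = p x :=
  ⟨{ emb := ⟨j.toFun.codRestrict p.domain h.emb_mem, h.norm_emb⟩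
     proj := (p.toFun.codRestrict j.domain h.proj_mem).mkContinuous 1
      fun x => by simpa using! h.norm_proj_le x
     norm_proj_le := LinearMap.mkContinuous_norm_le _ zero_le_one _
     proj_emb := fun y => Subtype.ext (h.proj_emb y) }, fun _ => rfl, fun _ => rfl⟩

/-- The union of a nonempty chain of partial double arrows. -/
theorem exists_of_isChain {c : Set ((Y →ₗ.[𝕜] E) × (E →ₗ.[𝕜] Y))}
    (hne : c.Nonempty) (hc : IsChain (· ≤ ·) c) (h : ∀ x ∈ c, IsPartialDoubleArrow x.1 x.2) :
    ∃ (j : Y →ₗ.[𝕜] E) (p : E →ₗ.[𝕜] Y), IsPartialDoubleArrow j p ∧ (∀ x ∈ c, x ≤ (j, p)) ∧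
      (j.domain : Set Y) = ⋃ x ∈ c, (x.1.domain : Set Y) ∧
      (p.domain : Set E) = ⋃ x ∈ c, (x.2.domain : Set E) := by
  have hdir : DirectedOn (· ≤ ·) c := hc.directedOn
  have h₁ : DirectedOn (· ≤ ·) (Prod.fst '' c) :=
    hdir.mono_comp (fun _ _ hxy => hxy.1)
  have h₂ : DirectedOn (· ≤ ·) (Prod.snd '' c) :=
    hdir.mono_comp (fun _ _ hxy => hxy.2)
  have le₁ : ∀ x ∈ c, x.1 ≤ LinearPMap.sSup _ h₁ := fun x hx =>
    LinearPMap.le_sSup h₁ (mem_image_of_mem _ hx)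
  have le₂ : ∀ x ∈ c, x.2 ≤ LinearPMap.sSup _ h₂ := fun x hx =>
    LinearPMap.le_sSup h₂ (mem_image_of_mem _ hx)
  have mem₁ : ∀ y : (LinearPMap.sSup _ h₁).domain, ∃ x ∈ c, (y : Y) ∈ x.1.domain := fun y => by
    simpa only [exists_mem_image] using
      (LinearPMap.mem_domain_sSup_iff (hne.image _) h₁).1 y.2
  have mem₂ : ∀ y : (LinearPMap.sSup _ h₂).domain, ∃ x ∈ c, (y : E) ∈ x.2.domain := fun y => by
    simpa only [exists_mem_image] using
      (LinearPMap.mem_domain_sSup_iff (hne.image _) h₂).1 y.2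
  have emb_mem : ∀ y, LinearPMap.sSup _ h₁ y ∈ (LinearPMap.sSup _ h₂).domain := fun y => by
    obtain ⟨x, hx, hy⟩ := mem₁ y
    rw [← (le₁ x hx).2 (x := ⟨y, hy⟩) rfl]
    exact (le₂ x hx).1 ((h x hx).emb_mem _)
  refine ⟨LinearPMap.sSup _ h₁, LinearPMap.sSup _ h₂, ⟨fun y => ?_, fun y => ?_, emb_mem,
    fun y => ?_, fun y => ?_⟩, fun x hx => ⟨le₁ x hx, le₂ x hx⟩, ?_, ?_⟩
  · obtain ⟨x, hx, hy⟩ := mem₁ y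
    rw [← (le₁ x hx).2 (x := ⟨y, hy⟩) rfl]
    exact (h x hx).norm_emb _
  · obtain ⟨x, hx, hy⟩ := mem₂ y
    rw [← (le₂ x hx).2 (x := ⟨y, hy⟩) rfl]
    exact (h x hx).norm_proj_le _
  · obtain ⟨x, hx, hy⟩ := mem₂ y
    rw [← (le₂ x hx).2 (x := ⟨y, hy⟩) rfl]
    exact (le₁ x hx).1 ((h x hx).proj_mem _)
  · obtain ⟨x, hx, hy⟩ := mem₁ y
    have := (h x hx).proj_emb ⟨y, hy⟩
    rwa [(le₂ x hx).2 (y := ⟨LinearPMap.sSup _ h₁ y, emb_mem y⟩)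
      ((le₁ x hx).2 (x := ⟨y, hy⟩) rfl)] at this
  · ext y
    simp only [mem_iUnion, SetLike.mem_coe, exists_prop]
    exact ⟨fun hy => mem₁ ⟨y, hy⟩, fun ⟨x, hx, hy⟩ => (le₁ x hx).1 hy⟩
  · ext y
    simp only [mem_iUnion, SetLike.mem_coe, exists_prop]
    exact ⟨fun hy => mem₂ ⟨y, hy⟩, fun ⟨x, hx, hy⟩ => (le₂ x hx).1 hy⟩

/-- A partial double arrow extends to the closures of its domains. -/
theorem closureExtension [CompleteSpace E] [CompleteSpace Y]
    {j : Y →ₗ.[𝕜] E} {p : E →ₗ.[𝕜] Y} (h : IsPartialDoubleArrow j p) :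
    IsPartialDoubleArrow j.closureExtension p.closureExtension := by
  have hj : ∀ y, ‖j y‖ ≤ ‖y‖ := fun y => (h.norm_emb y).le
  have hp := h.norm_proj_le
  have dj := j.domain.denseRange_inclusion_topologicalClosure
  have dp := p.domain.denseRange_inclusion_topologicalClosure
  have cj := j.continuous_closureExtension
  have cp := p.continuous_closureExtension
  have emb_mem : ∀ y, j.closureExtension y ∈ p.closureExtension.domain := by
    refine isClosed_property dj (p.domain.isClosed_topologicalClosure.preimage cj) fun y => ?_
    rw [LinearPMap.closureExtension_inclusion hj]
    exact p.domain.le_topologicalClosure (h.emb_mem y)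
  refine ⟨?_, LinearPMap.norm_closureExtension_le hp, emb_mem, ?_, ?_⟩
  · refine isClosed_property dj (isClosed_eq cj.norm continuous_norm) fun y => ?_
    rw [LinearPMap.closureExtension_inclusion hj]
    exact h.norm_emb y
  · refine isClosed_property dp (j.domain.isClosed_topologicalClosure.preimage cp) fun y => ?_
    rw [LinearPMap.closureExtension_inclusion hp]
    exact j.domain.le_topologicalClosure (h.proj_mem y)
  · refine isClosed_property dj
      (isClosed_eq (cp.comp (cj.subtype_mk emb_mem)) continuous_subtype_val) fun y => ?_
    refine Eq.trans ((LinearPMap.le_closureExtension hp).2 ?_).symm (h.proj_emb y)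
    exact (LinearPMap.closureExtension_inclusion hj y).symm

end IsPartialDoubleArrow

end PartialDoubleArrows

/-! ### Extending double arrows into a space of universal complemented disposition -/

section Extension

universe u₁ u₂ u₃

/-- A point of a separable metric space is determined by its distances to a dense sequence. -/
theorem Small.of_separableSpace (X : Type u) [MetricSpace X] [TopologicalSpace.SeparableSpace X] :
    Small.{0} X := by
  rcases isEmpty_or_nonempty X with _ | _
  · infer_instance
  refine small_of_injective (β := ℕ → ℝ)
    (f := fun x n => dist x (TopologicalSpace.denseSeq X n)) fun x y hxy => ?_
  have h : (fun z => dist x z) = fun z => dist y z :=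
    (TopologicalSpace.denseRange_denseSeq X).equalizer (by fun_prop) (by fun_prop) hxy
  have := congrFun h y
  simpa using this

variable {𝕜 : Type w} [RCLike 𝕜]

namespace DoubleArrow

variable {A : Type u₁} [NormedAddCommGroup A] [NormedSpace 𝕜 A]
  {B : Type u₂} [NormedAddCommGroup B] [NormedSpace 𝕜 B]
  {C : Type u₃} [NormedAddCommGroup C] [NormedSpace 𝕜 C]

theorem norm_proj_apply_le (d : DoubleArrow 𝕜 A B) (x : B) : ‖d.proj x‖ ≤ ‖x‖ :=
  d.proj.le_of_opNorm_le d.norm_proj_le x |>.trans_eq (one_mul _)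

/-- Composition of double arrows. -/
def comp (e : DoubleArrow 𝕜 B C) (d : DoubleArrow 𝕜 A B) : DoubleArrow 𝕜 A C where
  emb := e.emb.comp d.emb
  proj := d.proj.comp e.proj
  norm_proj_le := ContinuousLinearMap.opNorm_le_bound _ zero_le_one fun x => by
    simpa using (d.norm_proj_apply_le _).trans (e.norm_proj_apply_le x)
  proj_emb a := by simp [e.proj_emb, d.proj_emb]

/-- A linear isometric equivalence as a double arrow. -/
def ofEquiv (e : A ≃ₗᵢ[𝕜] B) : DoubleArrow 𝕜 A B where
  emb := e.toLinearIsometry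
  proj := e.symm.toContinuousLinearEquiv.toContinuousLinearMap
  norm_proj_le := ContinuousLinearMap.opNorm_le_bound _ zero_le_one fun x => by simp
  proj_emb a := by simp

/-- The amalgam of double arrows `i : A ⇄ B` and `q : A ⇄ C`: the pullback of the two projections,
that is, the space of all `(b, c)` with `i.proj b = q.proj c`, with the maximum norm. -/
def amalgam (i : DoubleArrow 𝕜 A B) (q : DoubleArrow 𝕜 A C) : Submodule 𝕜 (B × C) :=
  LinearMap.eqLocus (i.proj.comp (ContinuousLinearMap.fst 𝕜 B C)).toLinearMap
    (q.proj.comp (ContinuousLinearMap.snd 𝕜 B C)).toLinearMap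

theorem isClosed_amalgam (i : DoubleArrow 𝕜 A B) (q : DoubleArrow 𝕜 A C) :
    IsClosed (i.amalgam q : Set (B × C)) :=
  isClosed_eq (f := fun x : B × C => i.proj x.1) (g := fun x => q.proj x.2)
    (by fun_prop) (by fun_prop)

/-- The double arrow `B ⇄ i.amalgam q` with embedding `b ↦ (b, q (i.proj b))` and projection
`(b, c) ↦ b`. -/
def amalgamLeft (i : DoubleArrow 𝕜 A B) (q : DoubleArrow 𝕜 A C) :
    DoubleArrow 𝕜 B (i.amalgam q) where
  emb :=
    { toFun := fun b => ⟨(b, q.emb (i.proj b)), (q.proj_emb (i.proj b)).symm⟩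
      map_add' := fun x y => Subtype.ext (by simp)
      map_smul' := fun c x => Subtype.ext (by simp)
      norm_map' := fun b => by
        change ‖(b, q.emb (i.proj b))‖ = ‖b‖
        rw [Prod.norm_mk, q.emb.norm_map]
        exact max_eq_left (i.norm_proj_apply_le b) }
  proj := (ContinuousLinearMap.fst 𝕜 B C).comp (i.amalgam q).subtypeL
  norm_proj_le := ContinuousLinearMap.opNorm_le_bound _ zero_le_one fun x => by
    simpa using! norm_fst_le (x : B × C)
  proj_emb _ := rfl

/-- The double arrow `C ⇄ i.amalgam q` with embedding `c ↦ (i (q.proj c), c)` and projection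
`(b, c) ↦ c`. -/
def amalgamRight (i : DoubleArrow 𝕜 A B) (q : DoubleArrow 𝕜 A C) :
    DoubleArrow 𝕜 C (i.amalgam q) where
  emb :=
    { toFun := fun c => ⟨(i.emb (q.proj c), c), i.proj_emb (q.proj c)⟩
      map_add' := fun x y => Subtype.ext (by simp)
      map_smul' := fun c x => Subtype.ext (by simp)
      norm_map' := fun c => by
        change ‖(i.emb (q.proj c), c)‖ = ‖c‖
        rw [Prod.norm_mk, i.emb.norm_map]
        exact max_eq_right (q.norm_proj_apply_le c) }
  proj := (ContinuousLinearMap.snd 𝕜 B C).comp (i.amalgam q).subtypeL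
  norm_proj_le := ContinuousLinearMap.opNorm_le_bound _ zero_le_one fun x => by
    simpa using! norm_snd_le (x : B × C)
  proj_emb _ := rfl

end DoubleArrow

/-- A linear isometric equivalence between a separable Banach space and one in `Type`. -/
noncomputable def shrinkLinearIsometryEquiv (X : Type u) [NormedAddCommGroup X] [NormedSpace 𝕜 X]
    [Small.{0} X] : Shrink.{0} X ≃ₗᵢ[𝕜] X :=
  ⟨(equivShrink X).symm.linearEquiv 𝕜, fun _ => rfl⟩

variable {E : Type u} [NormedAddCommGroup E] [NormedSpace 𝕜 E]

/-- The defining property of universal complemented disposition holds for separable Banach spaces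
in arbitrary universes, since these have isometric copies in `Type`. -/
theorem IsOmegaUCD.exists_extension (hE : IsOmegaUCD 𝕜 E)
    {S₁ : Type u₁} [NormedAddCommGroup S₁] [NormedSpace 𝕜 S₁] [CompleteSpace S₁]
    [TopologicalSpace.SeparableSpace S₁]
    {S₂ : Type u₂} [NormedAddCommGroup S₂] [NormedSpace 𝕜 S₂] [CompleteSpace S₂]
    [TopologicalSpace.SeparableSpace S₂]
    (i : DoubleArrow 𝕜 S₁ S₂) (j : DoubleArrow 𝕜 S₁ E) :
    ∃ J : DoubleArrow 𝕜 S₂ E, ∀ s, J.emb (i.emb s) = j.emb s := by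
  have := Small.of_separableSpace S₁
  have := Small.of_separableSpace S₂
  let e₁ := shrinkLinearIsometryEquiv (𝕜 := 𝕜) S₁
  let e₂ := shrinkLinearIsometryEquiv (𝕜 := 𝕜) S₂
  have := (completeSpace_congr e₁.isometry.isUniformEmbedding).2 ‹CompleteSpace S₁›
  have := (completeSpace_congr e₂.isometry.isUniformEmbedding).2 ‹CompleteSpace S₂›
  have := e₁.symm.surjective.denseRange.separableSpace e₁.symm.continuous
  have := e₂.symm.surjective.denseRange.separableSpace e₂.symm.continuous
  obtain ⟨J, hJ⟩ := hE _ _ (((DoubleArrow.ofEquiv e₂.symm).comp i).comp (DoubleArrow.ofEquiv e₁))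
    (j.comp (DoubleArrow.ofEquiv e₁))
  refine ⟨J.comp (DoubleArrow.ofEquiv e₂.symm), fun s => ?_⟩
  have h := hJ (e₁.symm s)
  simpa [DoubleArrow.comp, DoubleArrow.ofEquiv] using h

/-- Along with the embedding, the projection can be prescribed on a separable complemented
subspace `C`: extend the embedding of `C` to the amalgam of `i` and `q`. -/
theorem IsOmegaUCD.exists_extension_of_amalgam (hE : IsOmegaUCD 𝕜 E)
    {A : Type u₁} [NormedAddCommGroup A] [NormedSpace 𝕜 A]
    {B : Type u₂} [NormedAddCommGroup B] [NormedSpace 𝕜 B] [CompleteSpace B]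
    [TopologicalSpace.SeparableSpace B]
    {C : Type u₃} [NormedAddCommGroup C] [NormedSpace 𝕜 C] [CompleteSpace C]
    [TopologicalSpace.SeparableSpace C]
    (i : DoubleArrow 𝕜 A B) (q : DoubleArrow 𝕜 A C) (g : DoubleArrow 𝕜 C E) :
    ∃ J : DoubleArrow 𝕜 B E, (∀ a, J.emb (i.emb a) = g.emb (q.emb a)) ∧
      ∀ c, J.proj (g.emb c) = i.emb (q.proj c) := by
  have := (i.isClosed_amalgam q).completeSpace_coe
  have : TopologicalSpace.SeparableSpace (i.amalgam q) :=
    (TopologicalSpace.IsSeparable.of_separableSpace (i.amalgam q : Set (B × C))).separableSpace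
  obtain ⟨K, hK⟩ := hE.exists_extension (i.amalgamRight q) g
  refine ⟨K.comp (i.amalgamLeft q), fun a => ?_, fun c => ?_⟩
  · rw [← hK]
    change K.emb _ = K.emb _
    congr 1
    refine Subtype.ext (Prod.ext ?_ ?_)
    · change i.emb a = i.emb (q.proj (q.emb a))
      rw [q.proj_emb]
    · change q.emb (i.proj (i.emb a)) = q.emb a
      rw [i.proj_emb]
  · rw [← hK]
    change (i.amalgamLeft q).proj (K.proj (K.emb _)) = _
    rw [K.proj_emb]
    rfl

end Extension

/-! ### Complemented subspaces -/

section Complemented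

variable {𝕜 : Type w} [RCLike 𝕜] {E : Type u} [NormedAddCommGroup E] [NormedSpace 𝕜 E]

/-- The inclusion of the subspace `A` is the embedding of a double arrow `A ⇄ E`. -/
def Submodule.IsOneComplemented (A : Submodule 𝕜 E) : Prop :=
  ∃ d : DoubleArrow 𝕜 A E, ∀ x, d.emb x = x

theorem Submodule.IsOneComplemented.of_contraction {A : Submodule 𝕜 E} (P : E →ₗ[𝕜] A)
    (hP : ∀ x, ‖P x‖ ≤ ‖x‖) (h : ∀ a : A, P a = a) : A.IsOneComplemented :=
  ⟨{ emb := A.subtypeₗᵢ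
     proj := P.mkContinuous 1 fun x => by simpa using hP x
     norm_proj_le := LinearMap.mkContinuous_norm_le _ zero_le_one _
     proj_emb := h }, fun _ => rfl⟩

theorem Submodule.isOneComplemented_bot : (⊥ : Submodule 𝕜 E).IsOneComplemented :=
  .of_contraction 0 (by simp) fun _ => Subsingleton.elim _ _

theorem Submodule.IsOneComplemented.exists_doubleArrow {A B : Submodule 𝕜 E}
    (hA : A.IsOneComplemented) (hAB : A ≤ B) :
    ∃ d : DoubleArrow 𝕜 A B, ∀ x, (d.emb x : E) = x := by
  obtain ⟨d, hd⟩ := hA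
  refine ⟨{ emb := ⟨Submodule.inclusion hAB, fun _ => rfl⟩
            proj := d.proj.comp B.subtypeL
            norm_proj_le := ContinuousLinearMap.opNorm_le_bound _ zero_le_one fun x => by
              simpa using d.norm_proj_apply_le (x : E)
            proj_emb := fun a => ?_ }, fun _ => rfl⟩
  have := d.proj_emb a
  rwa [hd] at this

end Complemented

/-! ### Skeletons -/

section Skeletons

variable {𝕜 : Type w} [RCLike 𝕜] {E : Type u} [NormedAddCommGroup E] [NormedSpace 𝕜 E]

/-- The chain `V` is a skeleton as in `HasOmegaSkeleton`. -/
structure IsOmegaSkeleton (V : Ordinal.{0} → Submodule 𝕜 E) : Prop where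
  isClosed : ∀ α < ω₁, IsClosed (V α : Set E)
  isSeparable : ∀ α < ω₁, TopologicalSpace.IsSeparable (V α : Set E)
  mono : ∀ α β, α ≤ β → β < ω₁ → V α ≤ V β
  limit : ∀ β < ω₁, Order.IsSuccLimit β → (V β : Set E) = closure (⋃ α < β, (V α : Set E))
  succ : ∀ α < ω₁, ∃ d : DoubleArrow 𝕜 (V α) (V (α + 1)), ∀ x : V α, (d.emb x : E) = (x : E)
  dense : closure (⋃ α < (ω₁ : Ordinal.{0}), (V α : Set E)) = Set.univ

theorem HasOmegaSkeleton.exists_isOmegaSkeleton (h : HasOmegaSkeleton 𝕜 E) :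
    ∃ V : Ordinal.{0} → Submodule 𝕜 E, IsOmegaSkeleton V := by
  obtain ⟨V, h₁, h₂, h₃, h₄, h₅, h₆⟩ := h
  exact ⟨V, h₁, h₂, h₃, h₄, h₅, h₆⟩

theorem Ordinal.add_one_lt_omega_one {α : Ordinal.{0}} (hα : α < ω₁) : α + 1 < ω₁ :=
  (Cardinal.isSuccLimit_omega 1).add_one_lt hα

namespace IsOmegaSkeleton

variable {V : Ordinal.{0} → Submodule 𝕜 E}

theorem closure_iUnion_subset (hV : IsOmegaSkeleton V) {ι : Type*} [Countable ι]
    {a : ι → Ordinal.{0}} (ha : ∀ i, a i < ω₁) : closure (⋃ i, (V (a i) : Set E)) ⊆ V (⨆ i, a i) :=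
  closure_minimal
    (iUnion_subset fun i => hV.mono _ _ (Ordinal.le_iSup a i) (Ordinal.iSup_lt_omega_one ha))
    (hV.isClosed _ (Ordinal.iSup_lt_omega_one ha))

/-- The supremum is either attained or a limit ordinal, at which the skeleton is continuous. -/
theorem closure_iUnion (hV : IsOmegaSkeleton V) {ι : Type*} [Countable ι] [Nonempty ι]
    {a : ι → Ordinal.{0}} (ha : ∀ i, a i < ω₁) : closure (⋃ i, (V (a i) : Set E)) = V (⨆ i, a i) := by
  refine (hV.closure_iUnion_subset ha).antisymm ?_
  by_cases h : ∃ i, a i = ⨆ i, a i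
  · obtain ⟨i, hi⟩ := h
    rw [← hi]
    exact subset_closure.trans' (subset_iUnion (fun i => (V (a i) : Set E)) i)
  · push Not at h
    have hlt : ∀ i, a i < ⨆ i, a i := fun i => (Ordinal.le_iSup a i).lt_of_ne (h i)
    have hlim : Order.IsSuccLimit (⨆ i, a i) := by
      rw [Ordinal.isSuccLimit_iff, Order.isSuccPrelimit_iff_succ_lt]
      refine ⟨((hlt (Classical.arbitrary ι)).trans_le' (zero_le)).ne', fun b hb => ?_⟩
      obtain ⟨i, hi⟩ := Ordinal.lt_iSup_iff.1 hb
      exact (Order.succ_le_of_lt hi).trans_lt (hlt i)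
    rw [hV.limit _ (Ordinal.iSup_lt_omega_one ha) hlim]
    refine closure_mono (iUnion₂_subset fun β hβ => ?_)
    obtain ⟨i, hi⟩ := Ordinal.lt_iSup_iff.1 hβ
    exact subset_iUnion_of_subset i (hV.mono _ _ hi.le (ha i))

/-- The union of a skeleton is closed, since a convergent sequence in it lies in a single member;
so density makes it the whole space. -/
theorem exists_mem (hV : IsOmegaSkeleton V) (x : E) : ∃ α < ω₁, x ∈ V α := by
  have hx : x ∈ closure (⋃ α < (ω₁ : Ordinal.{0}), (V α : Set E)) := hV.dense ▸ mem_univ x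
  obtain ⟨s, hs, hsx⟩ := mem_closure_iff_seq_limit.1 hx
  simp only [mem_iUnion, exists_prop] at hs
  choose a ha hsa using hs
  exact ⟨⨆ n, a n, Ordinal.iSup_lt_omega_one ha, hV.closure_iUnion_subset ha
    (mem_closure_of_tendsto hsx (.of_forall fun n => mem_iUnion.2 ⟨n, hsa n⟩))⟩

theorem exists_subset_of_isSeparable (hV : IsOmegaSkeleton V) {S : Set E}
    (hS : TopologicalSpace.IsSeparable S) :
    ∃ α < ω₁, S ⊆ V α := by
  obtain ⟨c, hc, hSc⟩ := hS
  choose a ha hxa using hV.exists_mem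
  have := hc.to_subtype
  refine ⟨⨆ x : c, a x, Ordinal.iSup_lt_omega_one fun x => ha x, hSc.trans ?_⟩
  refine (closure_mono fun x hx => ?_).trans (hV.closure_iUnion_subset fun x : c => ha x)
  exact mem_iUnion.2 ⟨⟨x, hx⟩, hxa x⟩

/-- Every member `V γ` of a skeleton is complemented in the whole space: a maximal contractive
extension of the identity of `V γ` is everywhere defined, provided that only those domains are
admitted which, for each `δ`, contain `V (δ + 1)` or are contained in `V δ`. -/
theorem isOneComplemented (hV : IsOmegaSkeleton V) [CompleteSpace E] {γ : Ordinal.{0}}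
    (hγ : γ < ω₁) :
    (V γ).IsOneComplemented := by
  have := (hV.isClosed γ hγ).completeSpace_coe
  -- the gap condition on domains matters at successor steps, where `p` is composed with a
  -- projection `V (δ + 1) → V δ` and so must not be defined beyond `V δ`
  let p₀ : E →ₗ.[𝕜] V γ := ⟨V γ, LinearMap.id⟩
  let S : Set (E →ₗ.[𝕜] V γ) := {p | p₀ ≤ p ∧ (∀ x, ‖p x‖ ≤ ‖x‖) ∧
    ∀ δ < ω₁, V (δ + 1) ≤ p.domain ∨ p.domain ≤ V δ}
  have hp₀ : p₀ ∈ S := by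
    refine ⟨le_rfl, fun x => le_rfl, fun δ hδ => ?_⟩
    rcases lt_or_ge δ γ with h | h
    · exact Or.inl (hV.mono _ _ (Order.add_one_le_of_lt h) hγ)
    · exact Or.inr (hV.mono _ _ h hδ)
  obtain ⟨p, -, hp⟩ := zorn_le_nonempty₀ S (fun c hcS hc q hq => by
    have hdir : DirectedOn (· ≤ ·) c := hc.directedOn
    refine ⟨LinearPMap.sSup c hdir, ⟨?_, fun x => ?_, fun δ hδ => ?_⟩,
      fun z hz => LinearPMap.le_sSup hdir hz⟩
    · exact (hcS hq).1.trans (LinearPMap.le_sSup hdir hq)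
    · obtain ⟨f, hf, hx⟩ := (LinearPMap.mem_domain_sSup_iff ⟨q, hq⟩ hdir).1 x.2
      rw [← (LinearPMap.le_sSup hdir hf).2 (x := ⟨x, hx⟩) rfl]
      exact (hcS hf).2.1 _
    · by_cases h : ∃ f ∈ c, V (δ + 1) ≤ f.domain
      · obtain ⟨f, hf, hle⟩ := h
        exact Or.inl (hle.trans (LinearPMap.le_sSup hdir hf).1)
      · push Not at h
        refine Or.inr fun x hx => ?_
        obtain ⟨f, hf, hx⟩ := (LinearPMap.mem_domain_sSup_iff ⟨q, hq⟩ hdir).1 hx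
        exact ((hcS hf).2.2 δ hδ).resolve_left (h f hf) hx) p₀ hp₀
  obtain ⟨⟨hpp, hnorm, hgap⟩, hmax⟩ := hp
  -- by maximality, an extension of `p` to some `V δ` is not proper
  have extend : ∀ q : E →ₗ.[𝕜] V γ, p ≤ q → (∀ x, ‖q x‖ ≤ ‖x‖) →
      ∀ δ < ω₁, q.domain = V δ → V δ ≤ p.domain := by
    intro q hpq hq δ hδ hdom
    have hqS : q ∈ S := by
      refine ⟨hpp.trans hpq, hq, fun ε hε => ?_⟩
      rw [hdom]
      rcases lt_or_ge ε δ with h | h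
      · exact Or.inl (hV.mono _ _ (Order.add_one_le_of_lt h) hδ)
      · exact Or.inr (hV.mono _ _ h hε)
    rw [← hdom]
    exact (hmax hqS hpq).1
  have total : ∀ δ, δ < ω₁ → V δ ≤ p.domain := by
    intro δ
    induction δ using Ordinal.limitRecOn with
    | zero => exact fun _ => (hV.mono 0 γ zero_le hγ).trans hpp.1
    | add_one δ ih =>
      intro hδ1
      have hδ : δ < ω₁ := (Order.lt_add_one_iff.2 le_rfl).trans hδ1
      rcases hgap δ hδ with h | h
      · exact h
      obtain ⟨d, hd⟩ := hV.succ δ hδ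
      let q : E →ₗ.[𝕜] V γ :=
        ⟨V (δ + 1), p.toFun.comp ((Submodule.inclusion (ih hδ)).comp d.proj.toLinearMap)⟩
      refine extend q ⟨h.trans (hV.mono _ _ le_self_add hδ1), fun x y hxy => ?_⟩ (fun x => ?_)
        (δ + 1) hδ1 rfl
      · change p x = p (Submodule.inclusion (ih hδ) (d.proj y))
        congr 1
        have hy : y = d.emb ⟨x, h x.2⟩ := Subtype.ext (by rw [hd]; exact hxy.symm)
        rw [hy, d.proj_emb]
        rfl
      · exact (hnorm _).trans (d.norm_proj_apply_le x)
    | limit δ hlim ih =>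
      intro hδ
      have hle : ∀ β < δ, V β ≤ p.domain := fun β hβ => ih β hβ (hβ.trans hδ)
      by_cases h : p.domain ≤ V δ
      · refine extend p.closureExtension (LinearPMap.le_closureExtension hnorm)
          (LinearPMap.norm_closureExtension_le hnorm) δ hδ (SetLike.coe_injective ?_)
        refine Subset.antisymm (closure_minimal h (hV.isClosed δ hδ)) ?_
        rw [hV.limit δ hδ hlim]
        exact closure_mono (iUnion₂_subset hle)
      · exact (hV.mono _ _ le_self_add (Ordinal.add_one_lt_omega_one hδ)).trans
          ((hgap δ hδ).resolve_right h)
  have htop : ∀ x, x ∈ p.domain := fun x => by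
    obtain ⟨δ, hδ, hx⟩ := hV.exists_mem x
    exact total δ hδ hx
  refine .of_contraction (p.toFun.comp (LinearMap.id.codRestrict p.domain htop))
    (fun x => hnorm _) fun a => (hpp.2 (x := a) rfl).symm

end IsOmegaSkeleton

/-- One step of the construction: a separable partial double arrow between complemented subspaces
can be extended to arbitrarily large members of two skeletons. -/
theorem IsPartialDoubleArrow.exists_le [CompleteSpace E]
    {Y : Type v} [NormedAddCommGroup Y] [NormedSpace 𝕜 Y] [CompleteSpace Y]
    {V : Ordinal.{0} → Submodule 𝕜 Y} (hV : IsOmegaSkeleton V)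
    {W : Ordinal.{0} → Submodule 𝕜 E} (hW : IsOmegaSkeleton W) (hE : IsOmegaUCD 𝕜 E)
    {j : Y →ₗ.[𝕜] E} {p : E →ₗ.[𝕜] Y} (h : IsPartialDoubleArrow j p)
    (hjc : j.domain.IsOneComplemented) (hpc : p.domain.IsOneComplemented)
    (hpcl : IsClosed (p.domain : Set E)) {α : Ordinal.{0}} (hα : α < ω₁)
    (hjα : j.domain ≤ V α) {γ : Ordinal.{0}} (hγ : γ < ω₁) (hpγ : p.domain ≤ W γ) :
    ∃ (j' : Y →ₗ.[𝕜] E) (p' : E →ₗ.[𝕜] Y), IsPartialDoubleArrow j' p' ∧ j ≤ j' ∧ p ≤ p' ∧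
      j'.domain = V α ∧ ∃ γ' < ω₁, γ ≤ γ' ∧ p'.domain = W γ' := by
  have := (hV.isClosed α hα).completeSpace_coe
  have := (hV.isSeparable α hα).separableSpace
  have := hpcl.completeSpace_coe
  have := ((hW.isSeparable γ hγ).mono hpγ).separableSpace
  obtain ⟨i, hi⟩ := hjc.exists_doubleArrow hjα
  obtain ⟨q, hqe, hqp⟩ := h.nonempty_doubleArrow
  obtain ⟨g, hg⟩ := hpc
  obtain ⟨J, hJe, hJp⟩ := hE.exists_extension_of_amalgam i q g
  obtain ⟨β, hβ, hJβ⟩ := hW.exists_subset_of_isSeparable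
    (TopologicalSpace.isSeparable_range J.emb.continuous)
  have hγ' : max β γ < ω₁ := max_lt hβ hγ
  refine ⟨⟨V α, J.emb.toLinearMap⟩,
    ⟨W (max β γ), (V α).subtype.comp (J.proj.toLinearMap.comp (W (max β γ)).subtype)⟩,
    ⟨fun y => J.emb.norm_map y, fun x => J.norm_proj_apply_le x, fun y => ?_,
      fun x => (J.proj x).2, fun y => ?_⟩, ⟨hjα, fun x y hxy => ?_⟩,
    ⟨hpγ.trans (hW.mono _ _ (le_max_right _ _) hγ'), fun x y hxy => ?_⟩, rfl,
    max β γ, hγ', le_max_right _ _, rfl⟩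
  · exact hW.mono _ _ (le_max_left _ _) hγ' (hJβ (mem_range_self y))
  · exact congrArg Subtype.val (J.proj_emb y)
  · have hy : y = i.emb x := Subtype.ext (by rw [hi]; exact hxy.symm)
    change j x = J.emb y
    rw [hy, hJe, hg, hqe]
  · change p x = (J.proj (y : E) : Y)
    have hy : (y : E) = g.emb x := by rw [hg]; exact hxy.symm
    rw [hy, hJp, hi, hqp]

end Skeletons

/-! ### The `ω₁`-chain of partial double arrows -/

theorem mainTheorem12 (hCH : (𝔠 : Cardinal.{0}) = ℵ₁) {𝕜 : Type w} [RCLike 𝕜]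
    (E : Type u) [NormedAddCommGroup E] [NormedSpace 𝕜 E] [CompleteSpace E]
    (hE : IsOmegaUCD 𝕜 E) (hEs : HasOmegaSkeleton 𝕜 E)
    (Y : Type v) [NormedAddCommGroup Y] [NormedSpace 𝕜 Y] [CompleteSpace Y]
    (hYs : HasOmegaSkeleton 𝕜 Y) :
    Nonempty (DoubleArrow 𝕜 Y E) := by
  obtain ⟨V, hV⟩ := hYs.exists_isOmegaSkeleton
  obtain ⟨W, hW⟩ := hEs.exists_isOmegaSkeleton
  have hω : (0 : Ordinal.{0}) < ω₁ := Ordinal.omega_pos 1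
  -- the preorder of partial double arrows between members of the two skeletons
  let P : (Y →ₗ.[𝕜] E) × (E →ₗ.[𝕜] Y) → Prop := fun x => IsPartialDoubleArrow x.1 x.2 ∧
    (∃ α < ω₁, x.1.domain = V α) ∧ ∃ γ < ω₁, x.2.domain = W γ
  have bounded : ∀ c : Set (Subtype P), c.Countable → IsChain (· ≤ ·) c → BddAbove c := by
    intro c hcc hc
    rcases c.eq_empty_or_nonempty with rfl | hne
    -- the empty chain: extend the zero double arrow `⊥ ⇄ ⊥` to `V 0`
    · obtain ⟨j, p, h, -, -, hj, γ, hγ, -, hp⟩ := IsPartialDoubleArrow.bot.exists_le hV hW hE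
        Submodule.isOneComplemented_bot Submodule.isOneComplemented_bot
        isClosed_singleton hω bot_le hω bot_le
      exact ⟨⟨(j, p), h, ⟨0, hω, hj⟩, γ, hγ, hp⟩, by simp [upperBounds]⟩
    · have := hcc.to_subtype
      have := hne.to_subtype
      obtain ⟨j, p, h, hle, hj, hp⟩ := IsPartialDoubleArrow.exists_of_isChain
        (hne.image Subtype.val)
        (by
          rintro _ ⟨x, hx, rfl⟩ _ ⟨y, hy, rfl⟩ -
          exact hc.total hx hy)
        (by rintro _ ⟨x, -, rfl⟩; exact x.2.1)
      choose a ha hVa using fun x : Subtype P => x.2.2.1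
      choose b hb hWb using fun x : Subtype P => x.2.2.2
      refine ⟨⟨(j.closureExtension, p.closureExtension), h.closureExtension,
        ⟨⨆ x : c, a x, Ordinal.iSup_lt_omega_one fun x => ha x, SetLike.coe_injective ?_⟩,
        ⨆ x : c, b x, Ordinal.iSup_lt_omega_one fun x => hb x, SetLike.coe_injective ?_⟩,
        fun x hx => (hle x (mem_image_of_mem _ hx)).trans
          ⟨LinearPMap.le_closureExtension fun y => (h.norm_emb y).le,
            LinearPMap.le_closureExtension h.norm_proj_le⟩⟩
      · rw [← hV.closure_iUnion fun x : c => ha x]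
        change closure (j.domain : Set Y) = _
        simp only [hj, biUnion_image, hVa, iUnion_coe_set]
      · rw [← hW.closure_iUnion fun x : c => hb x]
        change closure (p.domain : Set E) = _
        simp only [hp, biUnion_image, hWb, iUnion_coe_set]
  have extend : ∀ δ < ω₁, ∀ x : Subtype P,
      ∃ y ∈ {y : Subtype P | V δ ≤ y.1.1.domain ∧ W δ ≤ y.1.2.domain}, x ≤ y := by
    rintro δ hδ ⟨⟨j, p⟩, h, ⟨α, hα, hj⟩, γ, hγ, hp⟩
    dsimp only at h hj hp
    have hα' := max_lt hα hδ
    have hγ' := max_lt hγ hδ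
    obtain ⟨j', p', h', hjj, hpp, hj', ε, hε, hγε, hp'⟩ := h.exists_le hV hW hE
      (hj ▸ hV.isOneComplemented hα) (hp ▸ hW.isOneComplemented hγ) (hp ▸ hW.isClosed γ hγ)
      hα' (hj ▸ hV.mono _ _ (le_max_left α δ) hα') hγ' (hp ▸ hW.mono _ _ (le_max_left γ δ) hγ')
    refine ⟨⟨(j', p'), h', ⟨_, hα', hj'⟩, ε, hε, hp'⟩, ⟨?_, ?_⟩, hjj, hpp⟩
    · exact (hV.mono _ _ (le_max_right α δ) hα').trans_eq hj'.symm
    · exact (hW.mono _ _ ((le_max_right γ δ).trans hγε) hε).trans_eq hp'.symm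
  obtain ⟨f, hfD, hf⟩ := exists_monotone_mem_of_countable_chains_bounded bounded _ extend
  obtain ⟨j, p, h, hle, -, -⟩ := IsPartialDoubleArrow.exists_of_isChain
    (c := (fun α => (f α).1) '' Iio ω₁) ⟨_, mem_image_of_mem _ (mem_Iio.2 hω)⟩ (by
      rintro _ ⟨α, hα, rfl⟩ _ ⟨β, hβ, rfl⟩ -
      exact (le_total α β).imp (fun hαβ => hf α β hαβ hβ) fun hβα => hf β α hβα hα)
    (by rintro _ ⟨α, -, rfl⟩; exact (f α).2.1)
  have hj : ∀ y, y ∈ j.domain := fun y => by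
    obtain ⟨α, hα, hy⟩ := hV.exists_mem y
    exact (hle _ (mem_image_of_mem _ hα)).1.1 ((hfD α hα).1 hy)
  have hp : ∀ x, x ∈ p.domain := fun x => by
    obtain ⟨α, hα, hx⟩ := hW.exists_mem x
    exact (hle _ (mem_image_of_mem _ hα)).2.1 ((hfD α hα).2 hx)
  exact ⟨{
    emb := ⟨j.toFun.comp (LinearMap.id.codRestrict j.domain hj), fun y => h.norm_emb ⟨y, hj y⟩⟩
    proj := (p.toFun.comp (LinearMap.id.codRestrict p.domain hp)).mkContinuous 1
      fun x => by simpa using! h.norm_proj_le ⟨x, hp x⟩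
    norm_proj_le := LinearMap.mkContinuous_norm_le _ zero_le_one _
    proj_emb := fun y => h.proj_emb ⟨y, hj y⟩ }⟩
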